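/- Let $p_1=2<p_2=3<\cdots$ be the primes and let $S_{i,n}=\{m : 1\le m\le n,\ p_i\mid m,\ p_j\nmid m \text{ for all } 1\le j<i\}$. For $n\ge 2$ let $G(n)$ be the partition of $\{2,\dots,n\}$ produced by the following greedy algorithm. Start with $G(2)=\{\{2\}\}$. Given $G(m-1)$ with its classes listed in the order in which they were opened, consider first the partition obtained by opening the new class $\{m\}$ (listed last), then, in order, the partitions obtained by adjoining $m$ to one of the classes of $G(m-1)$; $G(m)$ is the first of these candidates for which the number of conflicts caused by $m$ is minimal, where $a$ with $2\le a<m$ is in conflict with $m$ if $a,m$ lie in the same class and $\gcd(a,m)=1$, or in different classes and $\gcd(a,m)>1$. Proposition (Numbers with large prime factors). Let $n_0=3\cdot5\cdot7\cdot11\cdot13\cdot17\cdot19\cdot23=111\,546\,435$, and let $2\le n<n_0$ be an integer all of whose prime factors are $\ge 41$. Assume that every $m$ with $2\le m<n$ that has a prime factor $\le 37$ is placed by the algorithm as expected, i.e. $m$ lies in the same class of $G(m)$ as its smallest prime factor. Then $n$ lands in the class $S_{i,n}$, where $p_i$ is the smallest prime factor of $n$; that is, $n\in S_{i,n}$ and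 $S_{i,n}$ is a class of $G(n)$. -/

import Mathlib

/-- The `i`-th prime, with `p₁ = 2`, `p₂ = 3`, … (only used for `1 ≤ i`). -/
noncomputable def nthPrime (i : ℕ) : ℕ := Nat.nth Nat.Prime (i - 1)

/-- `S_{i,n}`: the positive integers `m ≤ n` that are divisible by `p_i` but by no smaller prime
`p_j`, `1 ≤ j < i`. -/
noncomputable def smallestPrimeClass (i n : ℕ) : Finset ℕ :=
  open Classical in
  (Finset.Icc 1 n).filter
    (fun m => nthPrime i ∣ m ∧ ∀ j, 1 ≤ j → j < i → ¬ nthPrime j ∣ m)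

/-- `a` and `b` lie in a common class of the partition `P` (a list of its classes). -/
def SameClass (P : List (Finset ℕ)) (a b : ℕ) : Prop :=
  ∃ O ∈ P, a ∈ O ∧ b ∈ O

instance (P : List (Finset ℕ)) (a b : ℕ) : Decidable (SameClass P a b) :=
  inferInstanceAs (Decidable (∃ O ∈ P, a ∈ O ∧ b ∈ O))

/-- The number of conflicts of the partition `P` of `{2, …, m}` caused by the pairs `(m, a)`,
`2 ≤ a < m`. The pair `(m, a)` is in conflict if `a` and `m` are in the same class although
`gcd a m = 1`, or in different classes although `gcd a m > 1`. -/
def newConflicts (P : List (Finset ℕ)) (m : ℕ) : ℕ :=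
  ((Finset.Ico 2 m).filter (fun a =>
    (SameClass P a m ∧ Nat.gcd a m = 1) ∨ (¬ SameClass P a m ∧ 1 < Nat.gcd a m))).card

/-- One step of the greedy algorithm: given the partition `P` of `{2, …, m - 1}`, start with the
candidate in which `{m}` is a new class (listed last), then try in turn to adjoin `m` to each class
of `P`, and switch to the new candidate whenever it causes strictly fewer conflicts. -/
def greedyStep (P : List (Finset ℕ)) (m : ℕ) : List (Finset ℕ) :=
  (List.range P.length).foldl
    (fun best j =>
      if newConflicts (P.modify j (insert m)) m < newConflicts best m
      then P.modify j (insert m) else best)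
    (P ++ [{m}])

/-- `G(n)`, the output of the natural greedy algorithm on the input `n ≥ 2`: the list of the classes
of a partition of `{2, …, n}`, in the order in which the classes were opened. -/
def greedy : ℕ → List (Finset ℕ)
  | 0 => []
  | 1 => []
  | 2 => [{2}]
  | n + 3 => greedyStep (greedy (n + 2)) (n + 3)

/-! The expected partition is the one by smallest prime factor, and induction shows that the
algorithm follows it as long as the hypothesis on small prime factors applies. A prime conflicts
with nothing when it opens a class, and a number with a prime factor at most 37 is placed by
hypothesis. What remains is a composite `n` with smallest prime factor `p ≥ 41`.

Relative to opening a new class, joining the class of a prime `q` changes the number of conflicts by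
(members coprime to `n`) − (members not coprime to `n`). For `q = p` this is minus the size of the
whole class. For `q > p` the gain is at most the size of a class that injects into that of `p`
(`card_minFac_eq_le`). For `q < p` there must be no gain: at least as many members of the class are
coprime to `n` as are not (`card_minFac_not_coprime_le_coprime`).

Dividing by `q` turns the last claim into one about `q`-rough numbers up to `x = (n - 1) / q`. Since
`n < 41 ^ 5`, it has at most four prime factors, all at least `p`, so few rough numbers share a
factor with it. The total is bounded below by exact counts modulo 1, 2, 6, 30 or 210, followed for
`q ≥ 11` by a union bound over the primes in `[11, q)`. When `x < p * q` the sieve is replaced by a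
direct count. The bound on `n` keeps `q` below 480 in the sieve range, where the sum of `1 / l` over
these primes is still less than 1. -/

/-! ### Rough numbers and union bounds. -/

/-- All prime factors of `m` are at least `q`. -/
def IsRough (q m : ℕ) : Prop := ∀ l : ℕ, l.Prime → l ∣ m → q ≤ l

open Classical in
/-- The number of `q`-rough `m` with `1 ≤ m ≤ x`. -/
noncomputable def roughCount (q x : ℕ) : ℕ := ((Finset.Icc 1 x).filter (IsRough q)).card

theorem IsRough.mono {z q m : ℕ} (h : IsRough q m) (hz : z ≤ q) : IsRough z m :=
  fun l hl hd => hz.trans (h l hl hd)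

theorem IsRough.of_dvd {q m k : ℕ} (h : IsRough q m) (hk : k ∣ m) : IsRough q k :=
  fun l hl hd => h l hl (hd.trans hk)

theorem isRough_one (q : ℕ) : IsRough q 1 := fun _ hl hd => absurd (Nat.dvd_one.mp hd) hl.ne_one

theorem IsRough.eq_one_or_le {q m : ℕ} (h : IsRough q m) (hm : 1 ≤ m) : m = 1 ∨ q ≤ m := by
  by_cases h1 : m = 1
  · exact Or.inl h1
  · exact Or.inr ((h _ (Nat.minFac_prime h1) (Nat.minFac_dvd m)).trans (Nat.minFac_le hm))

theorem IsRough.mul {q a b : ℕ} (ha : IsRough q a) (hb : IsRough q b) : IsRough q (a * b) :=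
  fun l hl hd => ((hl.dvd_mul).mp hd).elim (ha l hl) (hb l hl)

theorem Nat.Prime.isRough {p q : ℕ} (hp : p.Prime) (h : q ≤ p) : IsRough q p :=
  fun _ hl hd => ((Nat.prime_dvd_prime_iff_eq hl hp).mp hd) ▸ h

theorem minFac_mul_of_isRough {q m : ℕ} (hq : q.Prime) (h : IsRough q m) :
    (q * m).minFac = q := by
  refine le_antisymm (Nat.minFac_le_of_dvd hq.two_le (dvd_mul_right q m)) ?_
  refine (hq.isRough le_rfl).mul h _ (Nat.minFac_prime ?_) (Nat.minFac_dvd _)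
  exact fun h1 => hq.ne_one (Nat.eq_one_of_mul_eq_one_right h1)

theorem isRough_minFac (n : ℕ) : IsRough n.minFac n :=
  fun _ hl hd => Nat.minFac_le_of_dvd hl.two_le hd

open Classical in
theorem card_rough_multiples_le (z x r : ℕ) (hr : 0 < r) :
    ((Finset.Icc 1 x).filter (fun m => IsRough z m ∧ r ∣ m)).card ≤ roughCount z (x / r) := by
  refine Finset.card_le_card_of_injOn (· / r) ?_ ?_
  · intro m hm
    simp only [Finset.coe_filter, Finset.mem_Icc, Set.mem_ofPred_eq] at hm ⊢
    obtain ⟨⟨h1, h2⟩, h3, h4⟩ := hm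
    exact ⟨⟨Nat.div_pos (Nat.le_of_dvd h1 h4) hr, Nat.div_le_div_right h2⟩,
      h3.of_dvd (Nat.div_dvd_of_dvd h4)⟩
  · intro a ha b hb hab
    simp only [Finset.coe_filter, Set.mem_ofPred_eq] at ha hb
    exact (Nat.div_left_inj ha.2.2 hb.2.2).mp hab

open Classical in
/-- Union bound sieve: sieving out the primes in `[z, q)` from the `z`-rough numbers. -/
theorem roughCount_le_add_sum (z q x : ℕ) :
    roughCount z x ≤ roughCount q x +
      ∑ l ∈ (Finset.Ico z q).filter Nat.Prime, roughCount z (x / l) := by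
  have hsub : (Finset.Icc 1 x).filter (IsRough z) ⊆ (Finset.Icc 1 x).filter (IsRough q) ∪
      ((Finset.Ico z q).filter Nat.Prime).biUnion
        (fun l => (Finset.Icc 1 x).filter (fun m => IsRough z m ∧ l ∣ m)) := by
    intro m hm
    simp only [Finset.mem_union, Finset.mem_biUnion, Finset.mem_filter, Finset.mem_Ico] at hm ⊢
    by_cases h : IsRough q m
    · exact Or.inl ⟨hm.1, h⟩
    · simp only [IsRough, not_forall, not_le] at h
      obtain ⟨l, hl, hd, hlt⟩ := h
      exact Or.inr ⟨l, ⟨⟨hm.2 l hl hd, hlt⟩, hl⟩, hm.1, hm.2, hd⟩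
  refine (Finset.card_le_card hsub).trans ((Finset.card_union_le _ _).trans ?_)
  refine Nat.add_le_add_left (Finset.card_biUnion_le.trans (Finset.sum_le_sum ?_)) _
  intro l hl
  exact card_rough_multiples_le z x l (Finset.mem_filter.mp hl).2.pos

open Classical in
theorem card_rough_not_coprime_le (q x n : ℕ) (hn : n ≠ 0) :
    ((Finset.Icc 1 x).filter (fun m => IsRough q m ∧ 1 < m.gcd n)).card ≤
      ∑ r ∈ n.primeFactors, roughCount q (x / r) := by
  have hsub : (Finset.Icc 1 x).filter (fun m => IsRough q m ∧ 1 < m.gcd n) ⊆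
      n.primeFactors.biUnion
        (fun r => (Finset.Icc 1 x).filter (fun m => IsRough q m ∧ r ∣ m)) := by
    intro m hm
    simp only [Finset.mem_biUnion, Finset.mem_filter, Nat.mem_primeFactors] at hm ⊢
    obtain ⟨h1, h2, h3⟩ := hm
    have hp := Nat.minFac_prime h3.ne'
    have hd := Nat.minFac_dvd (m.gcd n)
    exact ⟨_, ⟨hp, hd.trans (Nat.gcd_dvd_right m n), hn⟩, h1, h2,
      hd.trans (Nat.gcd_dvd_left m n)⟩
  refine (Finset.card_le_card hsub).trans (Finset.card_biUnion_le.trans (Finset.sum_le_sum ?_))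
  intro r hr
  exact card_rough_multiples_le q x r (Nat.prime_of_mem_primeFactors hr).pos

theorem roughCount_mono {z q : ℕ} (h : z ≤ q) (x : ℕ) : roughCount q x ≤ roughCount z x := by
  classical
  refine Finset.card_le_card (fun m hm => ?_)
  simp only [Finset.mem_filter] at hm ⊢
  exact ⟨hm.1, hm.2.mono h⟩

/-! ### Explicit counts of rough numbers by periodicity. -/

theorem isRough_iff_coprime {z M : ℕ} (hM : ∀ l : ℕ, l.Prime → (l ∣ M ↔ l < z)) (m : ℕ) :
    IsRough z m ↔ M.Coprime m := by
  constructor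
  · intro h
    refine Nat.coprime_of_dvd fun l hl h1 h2 => ?_
    exact absurd (h l hl h2) (not_le.mpr ((hM l hl).mp h1))
  · intro h l hl hd
    by_contra hlt
    exact hl.ne_one (Nat.eq_one_of_dvd_coprimes h ((hM l hl).mpr (not_le.mp hlt)) hd)

theorem roughCount_eq_card_coprime {z M : ℕ} (hM : ∀ l : ℕ, l.Prime → (l ∣ M ↔ l < z)) (y : ℕ) :
    roughCount z y = ((Finset.Icc 1 y).filter (M.Coprime ·)).card := by
  classical
  unfold roughCount
  congr 1
  ext m
  simp only [Finset.mem_filter, isRough_iff_coprime hM]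

theorem card_coprime_add (M y : ℕ) :
    ((Finset.Icc 1 (y + M)).filter (M.Coprime ·)).card =
      ((Finset.Icc 1 y).filter (M.Coprime ·)).card + M.totient := by
  rw [← Nat.filter_coprime_Ico_eq_totient M (y + 1), ← Finset.card_union_of_disjoint]
  · congr 1
    ext m
    simp only [Finset.mem_filter, Finset.mem_union, Finset.mem_Icc, Finset.mem_Ico]
    constructor
    · rintro ⟨h1, h2⟩
      rcases le_or_gt m y with h | h
      · exact Or.inl ⟨⟨h1.1, h⟩, h2⟩
      · exact Or.inr ⟨⟨h, by omega⟩, h2⟩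
    · rintro (⟨h1, h2⟩ | ⟨h1, h2⟩) <;> exact ⟨by omega, h2⟩
  · rw [Finset.disjoint_left]
    intro m h1 h2
    simp only [Finset.mem_filter, Finset.mem_Icc, Finset.mem_Ico] at h1 h2
    omega

/-- Raising `y` by `M` adds `M * φ(M)` to both sides of each inequality, so the discrepancy is
periodic and one period decides it. -/
theorem card_coprime_bounds {M a b : ℕ} (hM : 0 < M)
    (h : ∀ y < M, M * ((Finset.Icc 1 y).filter (M.Coprime ·)).card ≤ M.totient * y + b ∧
      M.totient * y ≤ M * ((Finset.Icc 1 y).filter (M.Coprime ·)).card + a) (y : ℕ) :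
    M * ((Finset.Icc 1 y).filter (M.Coprime ·)).card ≤ M.totient * y + b ∧
      M.totient * y ≤ M * ((Finset.Icc 1 y).filter (M.Coprime ·)).card + a := by
  induction y using Nat.strong_induction_on with
  | _ y ih =>
    rcases lt_or_ge y M with hy | hy
    · exact h y hy
    · obtain ⟨k, rfl⟩ := Nat.exists_eq_add_of_le' hy
      have := ih k (by omega)
      rw [card_coprime_add, mul_add, mul_add, mul_comm M M.totient]
      omega

theorem roughCount_bounds {z M f a b : ℕ} (hM : 0 < M)
    (hz : ∀ l : ℕ, l.Prime → (l ∣ M ↔ l < z)) (hf : M.totient = f)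
    (h : ∀ y < M, M * ((Finset.Icc 1 y).filter (M.Coprime ·)).card ≤ f * y + b ∧
      f * y ≤ M * ((Finset.Icc 1 y).filter (M.Coprime ·)).card + a) (y : ℕ) :
    M * roughCount z y ≤ f * y + b ∧ f * y ≤ M * roughCount z y + a := by
  subst hf
  rw [roughCount_eq_card_coprime hz]
  exact card_coprime_bounds hM h y

theorem roughCount_two_bounds (y : ℕ) :
    1 * roughCount 2 y ≤ 1 * y + 0 ∧ 1 * y ≤ 1 * roughCount 2 y + 0 := by
  refine roughCount_bounds one_pos (fun l hl => ?_) (by decide) (by decide) y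
  have := hl.two_le
  rw [Nat.dvd_one]
  omega

theorem roughCount_three_bounds (y : ℕ) :
    2 * roughCount 3 y ≤ 1 * y + 1 ∧ 1 * y ≤ 2 * roughCount 3 y + 0 := by
  refine roughCount_bounds two_pos (fun l hl => ?_) (by decide) (by decide) y
  have := hl.two_le
  rw [Nat.prime_dvd_prime_iff_eq hl Nat.prime_two]
  omega

theorem roughCount_five_bounds (y : ℕ) :
    6 * roughCount 5 y ≤ 2 * y + 4 ∧ 2 * y ≤ 6 * roughCount 5 y + 2 := by
  refine roughCount_bounds (by norm_num) (fun l hl => ?_) (by decide) (by decide) y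
  rw [show 6 = 2 * 3 by rfl, hl.dvd_mul, Nat.prime_dvd_prime_iff_eq hl Nat.prime_two,
    Nat.prime_dvd_prime_iff_eq hl Nat.prime_three]
  refine ⟨by omega, fun h => ?_⟩
  interval_cases l <;> revert hl <;> decide

theorem roughCount_seven_bounds (y : ℕ) :
    30 * roughCount 7 y ≤ 8 * y + 28 ∧ 8 * y ≤ 30 * roughCount 7 y + 20 := by
  refine roughCount_bounds (by norm_num) (fun l hl => ?_) (by decide +kernel)
    (by decide +kernel) y
  rw [show 30 = 2 * 3 * 5 by rfl, hl.dvd_mul, hl.dvd_mul,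
    Nat.prime_dvd_prime_iff_eq hl Nat.prime_two, Nat.prime_dvd_prime_iff_eq hl Nat.prime_three,
    Nat.prime_dvd_prime_iff_eq hl Nat.prime_five]
  refine ⟨by omega, fun h => ?_⟩
  interval_cases l <;> revert hl <;> decide

theorem roughCount_eleven_bounds (y : ℕ) :
    210 * roughCount 11 y ≤ 48 * y + 318 ∧ 48 * y ≤ 210 * roughCount 11 y + 270 := by
  refine roughCount_bounds (by norm_num) (fun l hl => ?_) (by decide +kernel)
    (by decide +kernel) y
  rw [show 210 = 2 * 3 * 5 * 7 by rfl, hl.dvd_mul, hl.dvd_mul, hl.dvd_mul,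
    Nat.prime_dvd_prime_iff_eq hl Nat.prime_two, Nat.prime_dvd_prime_iff_eq hl Nat.prime_three,
    Nat.prime_dvd_prime_iff_eq hl Nat.prime_five, Nat.prime_dvd_prime_iff_eq hl Nat.prime_seven]
  refine ⟨by omega, fun h => ?_⟩
  interval_cases l <;> revert hl <;> decide

/-! ### Rough numbers coprime to `n` against the others. -/

/-- The summand exceeds `10 ^ 6 / l` taken as a real number, so this and the next three are upper
bounds for sums of prime reciprocals in units of `10 ^ (-6)`. -/
theorem sum_inv_primes_le_41 :
    ((Finset.Ico 11 41).filter Nat.Prime).card ≤ 8 ∧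
      ∑ l ∈ (Finset.Ico 11 41).filter Nat.Prime, (10 ^ 6 / l + 1) ≤ 416539 := by decide +kernel

theorem sum_inv_primes_le_60 :
    ((Finset.Ico 11 60).filter Nat.Prime).card ≤ 13 ∧
      ∑ l ∈ (Finset.Ico 11 60).filter Nat.Prime, (10 ^ 6 / l + 1) ≤ 522000 := by decide +kernel

theorem sum_inv_primes_le_150 :
    ((Finset.Ico 11 150).filter Nat.Prime).card ≤ 31 ∧
      ∑ l ∈ (Finset.Ico 11 150).filter Nat.Prime, (10 ^ 6 / l + 1) ≤ 710336 := by decide +kernel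

theorem sum_inv_primes_le_480 :
    ((Finset.Ico 11 480).filter Nat.Prime).card ≤ 88 ∧
      ∑ l ∈ (Finset.Ico 11 480).filter Nat.Prime, (10 ^ 6 / l + 1) ≤ 914471 := by decide +kernel

open Classical in
theorem card_rough_coprime_add_not (q x n : ℕ) :
    ((Finset.Icc 1 x).filter (fun m => IsRough q m ∧ 1 < m.gcd n)).card +
      ((Finset.Icc 1 x).filter (fun m => IsRough q m ∧ m.gcd n = 1)).card = roughCount q x := by
  rw [← Finset.card_union_of_disjoint]
  · unfold roughCount
    congr 1
    ext m
    simp only [Finset.mem_union, Finset.mem_filter, Finset.mem_Icc]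
    constructor
    · rintro (⟨h1, h2, -⟩ | ⟨h1, h2, -⟩) <;> exact ⟨h1, h2⟩
    · rintro ⟨h1, h2⟩
      have : 0 < m.gcd n := Nat.gcd_pos_of_pos_left _ h1.1
      rcases Nat.lt_or_ge 1 (m.gcd n) with h | h
      · exact Or.inl ⟨h1, h2, h⟩
      · exact Or.inr ⟨h1, h2, by omega⟩
  · rw [Finset.disjoint_left]
    intro m h1 h2
    simp only [Finset.mem_filter] at h1 h2
    omega

open Classical in
/-- If the union bound sieve by the primes in `[z, q)` leaves enough, at least half of the
`q`-rough numbers up to `x` are coprime to `n`. -/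
theorem card_rough_not_coprime_le_coprime {z M f a b S T q x n p : ℕ} (hM : 0 < M)
    (hb : ∀ y, M * roughCount z y ≤ f * y + b ∧ f * y ≤ M * roughCount z y + a)
    (hzq : z ≤ q) (hn : n ≠ 0) (hp : 0 < p) (hpn : ∀ r ∈ n.primeFactors, p ≤ r)
    (hcard : n.primeFactors.card ≤ 4)
    (hT : ((Finset.Ico z q).filter Nat.Prime).card ≤ T)
    (hS : ∑ l ∈ (Finset.Ico z q).filter Nat.Prime, (10 ^ 6 / l + 1) ≤ S)
    (hfin : 10 ^ 6 * (a + b * T + 8 * (f * (x / p) + b)) + f * x * S ≤ 10 ^ 6 * (f * x)) :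
    ((Finset.Icc 1 x).filter (fun m => IsRough q m ∧ 1 < m.gcd n)).card ≤
      ((Finset.Icc 1 x).filter (fun m => IsRough q m ∧ m.gcd n = 1)).card := by
  have h0 := card_rough_coprime_add_not q x n
  have h1 := card_rough_not_coprime_le q x n hn
  have h2 := roughCount_le_add_sum z q x
  have h3 := (hb x).2
  have h4 : M * ∑ r ∈ n.primeFactors, roughCount q (x / r) ≤ 4 * (f * (x / p) + b) := by
    rw [Finset.mul_sum]
    refine (Finset.sum_le_card_nsmul _ _ (f * (x / p) + b) fun r hr => ?_).trans ?_
    · refine (Nat.mul_le_mul_left M (roughCount_mono hzq _)).trans ((hb _).1.trans ?_)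
      gcongr
      exact hpn r hr
    · rw [smul_eq_mul]
      exact Nat.mul_le_mul_right _ hcard
  -- The sieved-out part: the main term is `f * x` times the reciprocal sum, and each sieving prime
  -- costs one error `b`.
  have h5 : 10 ^ 6 * (M * ∑ l ∈ (Finset.Ico z q).filter Nat.Prime, roughCount z (x / l)) ≤
      f * x * S + 10 ^ 6 * (b * T) := by
    calc 10 ^ 6 * (M * ∑ l ∈ (Finset.Ico z q).filter Nat.Prime, roughCount z (x / l))
        ≤ ∑ l ∈ (Finset.Ico z q).filter Nat.Prime,
            (f * x * (10 ^ 6 / l + 1) + 10 ^ 6 * b) := by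
          rw [Finset.mul_sum, Finset.mul_sum]
          refine Finset.sum_le_sum fun l hl => ?_
          have hl0 : 0 < l := (Finset.mem_filter.mp hl).2.pos
          have e1 := (hb (x / l)).1
          have e2 : x / l * 10 ^ 6 ≤ x * (10 ^ 6 / l + 1) := by
            have e3 : 10 ^ 6 ≤ l * (10 ^ 6 / l + 1) :=
              (Nat.lt_mul_div_succ (10 ^ 6) hl0).le
            calc x / l * 10 ^ 6 ≤ x / l * (l * (10 ^ 6 / l + 1)) := Nat.mul_le_mul_left _ e3
              _ = (x / l * l) * (10 ^ 6 / l + 1) := by ring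
              _ ≤ x * (10 ^ 6 / l + 1) := Nat.mul_le_mul_right _ (Nat.div_mul_le_self x l)
          calc 10 ^ 6 * (M * roughCount z (x / l)) ≤ 10 ^ 6 * (f * (x / l) + b) :=
                Nat.mul_le_mul_left _ e1
            _ = f * (x / l * 10 ^ 6) + 10 ^ 6 * b := by ring
            _ ≤ f * (x * (10 ^ 6 / l + 1)) + 10 ^ 6 * b := by gcongr
            _ = _ := by ring
      _ = f * x * ∑ l ∈ (Finset.Ico z q).filter Nat.Prime, (10 ^ 6 / l + 1) +
            10 ^ 6 * (b * ((Finset.Ico z q).filter Nat.Prime).card) := by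
          rw [Finset.sum_add_distrib, Finset.mul_sum, Finset.sum_const, smul_eq_mul]
          ring
      _ ≤ _ := by gcongr
  have h6 : M * roughCount z x ≤ M * roughCount q x +
      M * ∑ l ∈ (Finset.Ico z q).filter Nat.Prime, roughCount z (x / l) := by
    rw [← mul_add]
    exact Nat.mul_le_mul_left M h2
  -- The factor 8 in `hfin` is this 2 times the at most four prime factors of `n`. Naming the
  -- products makes the inequality linear.
  have h7 : 2 * (M * ∑ r ∈ n.primeFactors, roughCount q (x / r)) ≤ M * roughCount q x := by
    generalize ∑ l ∈ (Finset.Ico z q).filter Nat.Prime, roughCount z (x / l) = A at *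
    generalize ∑ r ∈ n.primeFactors, roughCount q (x / r) = B at *
    generalize M * A = A' at *
    generalize M * B = B' at *
    generalize M * roughCount z x = C at *
    generalize M * roughCount q x = D at *
    generalize f * x * S = E at *
    generalize f * x = F at *
    generalize f * (x / p) = G at *
    generalize b * T = H at *
    omega
  have h8 : 2 * ∑ r ∈ n.primeFactors, roughCount q (x / r) ≤ roughCount q x :=
    Nat.le_of_mul_le_mul_left (by linarith) hM
  omega

theorem card_primeFactors_le_four {n : ℕ} (hn0 : n ≠ 0)
    (hn : n < 41 ^ 5) (hlarge : ∀ q : ℕ, q.Prime → q ∣ n → 41 ≤ q) :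
    n.primeFactors.card ≤ 4 := by
  by_contra! h
  have h1 : 41 ^ n.primeFactors.card ≤ ∏ r ∈ n.primeFactors, r :=
    Finset.pow_card_le_prod _ _ _ fun r hr =>
      hlarge r (Nat.prime_of_mem_primeFactors hr) (Nat.dvd_of_mem_primeFactors hr)
  have h2 : ∏ r ∈ n.primeFactors, r ≤ n :=
    Nat.le_of_dvd (Nat.pos_of_ne_zero hn0) (Nat.prod_primeFactors_dvd n)
  have h3 : 41 ^ 5 ≤ 41 ^ n.primeFactors.card := Nat.pow_le_pow_right (by norm_num) h
  omega

theorem card_primeFactors_le_two {n p : ℕ} (hn0 : n ≠ 0) (hp : 0 < p)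
    (hn : n < p ^ 3) (hpn : ∀ r ∈ n.primeFactors, p ≤ r) :
    n.primeFactors.card ≤ 2 := by
  by_contra! h
  have h1 : p ^ n.primeFactors.card ≤ ∏ r ∈ n.primeFactors, r := Finset.pow_card_le_prod _ _ _ hpn
  have h2 : ∏ r ∈ n.primeFactors, r ≤ n :=
    Nat.le_of_dvd (Nat.pos_of_ne_zero hn0) (Nat.prod_primeFactors_dvd n)
  have h3 : p ^ 3 ≤ p ^ n.primeFactors.card := Nat.pow_le_pow_right hp h
  omega

open Classical in
/-- For `x < p * q` every `q`-rough `m ≤ x` having a common factor with `n` is a prime factor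
of `n`. -/
theorem card_rough_not_coprime_le_of_lt {n p q x : ℕ} (hn0 : n ≠ 0) (hx : x < p * q)
    (hpn : ∀ r ∈ n.primeFactors, p ≤ r) :
    ((Finset.Icc 1 x).filter (fun m => IsRough q m ∧ 1 < m.gcd n)).card ≤
      n.primeFactors.card := by
  refine Finset.card_le_card fun m hm => ?_
  simp only [Finset.mem_filter, Finset.mem_Icc] at hm
  obtain ⟨⟨h1, h2⟩, h3, h4⟩ := hm
  have hr := Nat.minFac_prime h4.ne'
  have hd := Nat.minFac_dvd (m.gcd n)
  set r := (m.gcd n).minFac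
  have hrn : r ∈ n.primeFactors :=
    Nat.mem_primeFactors.mpr ⟨hr, hd.trans (Nat.gcd_dvd_right m n), hn0⟩
  obtain ⟨k, hk⟩ := hd.trans (Nat.gcd_dvd_left m n)
  have hk0 : 1 ≤ k := Nat.pos_of_ne_zero (by rintro rfl; omega)
  rcases (h3.of_dvd ⟨r, by rw [hk, mul_comm]⟩).eq_one_or_le hk0 with h | h
  · rw [hk, h, mul_one]
    exact hrn
  · have : p * q ≤ r * k := Nat.mul_le_mul (hpn r hrn) h
    omega

/-- With `y = x / p` and `x ≥ p₀ * y` the claim follows from an inequality linear in `y`: `h` is its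
value at `y = q₀`, and `h'` says that the slope is nonnegative. The constants 48, 270, 318 come from
the count modulo 210, and `384 = 8 * 48`. -/
theorem rough_bound_of_range {p q x S T p₀ q₀ : ℕ} (hp : p₀ ≤ p) (hq : q₀ ≤ q) (hp0 : 0 < p)
    (hx : p * q ≤ x) (hS : S ≤ 10 ^ 6)
    (h : 10 ^ 6 * (270 + 318 * T + 8 * 318) + q₀ * (384 * 10 ^ 6) ≤
      q₀ * (48 * p₀ * (10 ^ 6 - S)))
    (h' : 384 * 10 ^ 6 ≤ 48 * p₀ * (10 ^ 6 - S)) :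
    10 ^ 6 * (270 + 318 * T + 8 * (48 * (x / p) + 318)) + 48 * x * S ≤ 10 ^ 6 * (48 * x) := by
  obtain ⟨R, hR⟩ := Nat.exists_eq_add_of_le hS
  have hR' : 10 ^ 6 - S = R := by omega
  rw [hR'] at h h'
  have hy : q₀ ≤ x / p := hq.trans ((Nat.le_div_iff_mul_le hp0).mpr (by linarith))
  have hxy : p * (x / p) ≤ x := Nat.mul_div_le x p
  generalize x / p = y at *
  obtain ⟨d, rfl⟩ := Nat.exists_eq_add_of_le hy
  have e1 : d * (384 * 10 ^ 6) ≤ d * (48 * p₀ * R) := Nat.mul_le_mul_left d h'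
  have e2 : 48 * (p₀ * (q₀ + d)) * R ≤ 48 * x * R := by
    gcongr
    exact (Nat.mul_le_mul_right _ hp).trans hxy
  have e3 : 10 ^ 6 * (48 * x) = 48 * x * S + 48 * x * R := by rw [hR]; ring
  rw [e3]
  nlinarith

open Classical in
theorem card_rough_not_coprime_le_coprime_of_composite {n q : ℕ} (hn2 : 2 ≤ n)
    (hn : n < 111546435) (hlarge : ∀ q : ℕ, q.Prime → q ∣ n → 41 ≤ q) (hcomp : ¬ n.Prime)
    (hq : q.Prime) (hqp : q < n.minFac) :
    ((Finset.Icc 1 ((n - 1) / q)).filter (fun m => IsRough q m ∧ 1 < m.gcd n)).card ≤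
      ((Finset.Icc 1 ((n - 1) / q)).filter (fun m => IsRough q m ∧ m.gcd n = 1)).card := by
  have hn0 : n ≠ 0 := by omega
  have hpp : n.minFac.Prime := Nat.minFac_prime (by omega)
  have hp41 : 41 ≤ n.minFac := hlarge _ hpp (Nat.minFac_dvd n)
  have hpn : ∀ r ∈ n.primeFactors, n.minFac ≤ r := fun r hr =>
    isRough_minFac n r (Nat.prime_of_mem_primeFactors hr) (Nat.dvd_of_mem_primeFactors hr)
  have hsq : n.minFac ^ 2 ≤ n := Nat.minFac_sq_le_self (by omega) hcomp
  have hc4 := card_primeFactors_le_four hn0 (hn.trans (by norm_num)) hlarge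
  generalize hp : n.minFac = p at *
  have hq2 := hq.two_le
  have hxq : ∀ k, k * q < n ↔ k ≤ (n - 1) / q := fun k => by
    rw [Nat.le_div_iff_mul_le hq.pos]; omega
  rcases le_or_gt q 10 with hq10 | hq10
  · have hx : 239 ≤ (n - 1) / q := by
      have hq7 : q ≤ 7 := by
        by_contra! h
        interval_cases q <;> revert hq <;> decide
      rw [← hxq]; nlinarith
    have hxp : 41 * ((n - 1) / q / p) ≤ (n - 1) / q :=
      (Nat.mul_le_mul_right _ hp41).trans (Nat.mul_div_le _ p)
    have key : ∀ M f a b, 0 < M →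
        (∀ y, M * roughCount q y ≤ f * y + b ∧ f * y ≤ M * roughCount q y + a) →
        a + 8 * (f * ((n - 1) / q / p) + b) ≤ f * ((n - 1) / q) →
        ((Finset.Icc 1 ((n - 1) / q)).filter (fun m => IsRough q m ∧ 1 < m.gcd n)).card ≤
          ((Finset.Icc 1 ((n - 1) / q)).filter (fun m => IsRough q m ∧ m.gcd n = 1)).card := by
      intro M f a b hM hb h
      -- With `z = q` the count is already explicit and no prime is left to sieve.
      refine card_rough_not_coprime_le_coprime (S := 0) (T := 0) hM hb le_rfl hn0 hpp.pos hpn hc4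
        (by simp) (by simp) ?_
      simpa using h
    generalize (n - 1) / q / p = y at *
    generalize (n - 1) / q = x at *
    interval_cases q
    · exact key _ _ _ _ one_pos roughCount_two_bounds (by omega)
    · exact key _ _ _ _ two_pos roughCount_three_bounds (by omega)
    · exact absurd hq (by decide)
    · exact key _ _ _ _ (by norm_num) roughCount_five_bounds (by omega)
    · exact absurd hq (by decide)
    · exact key _ _ _ _ (by norm_num) roughCount_seven_bounds (by omega)
    · exact absurd hq (by decide)
    · exact absurd hq (by decide)
    · exact absurd hq (by decide)
  rcases lt_or_ge ((n - 1) / q) (p * q) with hx | hx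
  · have hnp : n < p ^ 3 := by
      by_contra! h
      have h1 : p * q * q < n := by
        have : p * q * q < p * p * p := by
          rw [mul_assoc, mul_assoc]
          exact Nat.mul_lt_mul_of_pos_left (Nat.mul_self_lt_mul_self hqp) hpp.pos
        rw [pow_three, ← mul_assoc] at h
        omega
      exact absurd ((hxq _).mp h1) (not_le.mpr hx)
    refine (card_rough_not_coprime_le_of_lt hn0 hx hpn).trans
      ((card_primeFactors_le_two hn0 hpp.pos hnp hpn).trans ?_)
    -- At most two rough numbers are not coprime to `n`; the numbers 1 and `q` are two that are.
    rw [← Finset.card_pair hq.ne_one.symm]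
    refine Finset.card_le_card fun m hm => ?_
    have hqx : q ≤ (n - 1) / q := by rw [← hxq]; nlinarith
    have hqn : q.gcd n = 1 := (Nat.Prime.coprime_iff_not_dvd hq).mpr fun hd =>
      absurd (Nat.minFac_le_of_dvd hq2 hd) (by omega)
    simp only [Finset.mem_insert, Finset.mem_singleton] at hm
    simp only [Finset.mem_filter, Finset.mem_Icc]
    rcases hm with rfl | rfl
    · exact ⟨⟨le_rfl, by omega⟩, isRough_one q, Nat.gcd_one_left n⟩
    · exact ⟨⟨hq.pos, hqx⟩, hq.isRough le_rfl, hqn⟩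
  · have hq480 : q < 480 := by
      by_contra! h
      have h1 := (hxq _).mpr hx
      have h2 : 481 * 480 * 480 ≤ p * q * q := by gcongr; omega
      have h3 : q ≤ 482 := by
        by_contra! h3
        have : 483 * 483 * 483 ≤ p * q * q := by gcongr <;> omega
        omega
      interval_cases q <;> revert hq <;> norm_num
    have hmono : ∀ v, q ≤ v → (Finset.Ico 11 q).filter Nat.Prime ⊆
        (Finset.Ico 11 v).filter Nat.Prime := fun v hv =>
      Finset.filter_subset_filter _ (Finset.Ico_subset_Ico_right hv)
    have key : ∀ v S T p₀ q₀, q ≤ v → p₀ ≤ p → q₀ ≤ q →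
        (((Finset.Ico 11 v).filter Nat.Prime).card ≤ T ∧
          ∑ l ∈ (Finset.Ico 11 v).filter Nat.Prime, (10 ^ 6 / l + 1) ≤ S) → S ≤ 10 ^ 6 →
        10 ^ 6 * (270 + 318 * T + 8 * 318) + q₀ * (384 * 10 ^ 6) ≤
          q₀ * (48 * p₀ * (10 ^ 6 - S)) →
        384 * 10 ^ 6 ≤ 48 * p₀ * (10 ^ 6 - S) →
        ((Finset.Icc 1 ((n - 1) / q)).filter (fun m => IsRough q m ∧ 1 < m.gcd n)).card ≤
          ((Finset.Icc 1 ((n - 1) / q)).filter (fun m => IsRough q m ∧ m.gcd n = 1)).card := by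
      intro v S T p₀ q₀ hv hp₀ hq₀ hST hS h h'
      exact card_rough_not_coprime_le_coprime (by norm_num) roughCount_eleven_bounds (by omega)
        hn0 hpp.pos hpn hc4 ((Finset.card_le_card (hmono v hv)).trans hST.1)
        ((Finset.sum_le_sum_of_subset (hmono v hv)).trans hST.2)
        (rough_bound_of_range hp₀ hq₀ hpp.pos hx hS h h')
    -- A longer sieve leaves a smaller main term, but `p > q` grows too; four ranges of `q` suffice
    -- to balance the two.
    rcases lt_or_ge q 41 with h | h
    · exact key 41 _ _ 41 11 h.le hp41 hq10 sum_inv_primes_le_41 (by norm_num) (by norm_num)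
        (by norm_num)
    rcases lt_or_ge q 60 with h | h
    · exact key 60 _ _ 42 41 h.le (by omega) (by omega) sum_inv_primes_le_60 (by norm_num)
        (by norm_num) (by norm_num)
    rcases lt_or_ge q 150 with h | h
    · exact key 150 _ _ 61 60 h.le (by omega) (by omega) sum_inv_primes_le_150 (by norm_num)
        (by norm_num) (by norm_num)
    · exact key 480 _ _ 151 150 hq480.le (by omega) (by omega) sum_inv_primes_le_480
        (by norm_num) (by norm_num) (by norm_num)

/-! ### The partition by smallest prime factor. -/

/-- The integers `2 ≤ m ≤ n` with smallest prime factor `p`. -/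
def minFacClass (p n : ℕ) : Finset ℕ := (Finset.Icc 2 n).filter (fun m => m.minFac = p)

/-- The primes up to `n` in increasing order. -/
def primesUpTo (n : ℕ) : List ℕ := (List.range (n + 1)).filter (fun p => decide p.Prime)

/-- The partition of `{2, …, n}` by the smallest prime factor. -/
def minFacPartition (n : ℕ) : List (Finset ℕ) := (primesUpTo n).map (fun p => minFacClass p n)

theorem mem_minFacClass {p n m : ℕ} : m ∈ minFacClass p n ↔ (2 ≤ m ∧ m ≤ n) ∧ m.minFac = p := by
  simp [minFacClass]

theorem mem_primesUpTo {n p : ℕ} : p ∈ primesUpTo n ↔ p ≤ n ∧ p.Prime := by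
  simp [primesUpTo]

theorem minFacClass_succ_of_eq {p n : ℕ} (hn : 1 ≤ n) (h : (n + 1).minFac = p) :
    minFacClass p (n + 1) = insert (n + 1) (minFacClass p n) := by
  ext m
  simp only [Finset.mem_insert, mem_minFacClass]
  constructor
  · rintro ⟨⟨h1, h2⟩, h3⟩
    rcases Nat.lt_or_ge n m with h4 | h4
    · exact Or.inl (by omega)
    · exact Or.inr ⟨⟨h1, h4⟩, h3⟩
  · rintro (rfl | ⟨⟨h1, h2⟩, h3⟩)
    · exact ⟨⟨by omega, le_rfl⟩, h⟩
    · exact ⟨⟨h1, by omega⟩, h3⟩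

theorem minFacClass_succ_of_ne {p n : ℕ} (h : (n + 1).minFac ≠ p) :
    minFacClass p (n + 1) = minFacClass p n := by
  ext m
  simp only [mem_minFacClass]
  constructor
  · rintro ⟨⟨h1, h2⟩, h3⟩
    refine ⟨⟨h1, ?_⟩, h3⟩
    rcases Nat.lt_or_ge n m with h4 | h4
    · exact absurd ((show m = n + 1 by omega) ▸ h3) h
    · exact h4
  · rintro ⟨⟨h1, h2⟩, h3⟩
    exact ⟨⟨h1, by omega⟩, h3⟩

theorem primesUpTo_sorted (n : ℕ) : (primesUpTo n).Pairwise (· < ·) :=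
  List.Pairwise.filter _ List.pairwise_lt_range

theorem primesUpTo_succ_of_prime {n : ℕ} (h : (n + 1).Prime) :
    primesUpTo (n + 1) = primesUpTo n ++ [n + 1] := by
  rw [primesUpTo, List.range_succ, List.filter_append]
  simp [primesUpTo, h]

theorem primesUpTo_succ_of_not_prime {n : ℕ} (h : ¬ (n + 1).Prime) :
    primesUpTo (n + 1) = primesUpTo n := by
  rw [primesUpTo, List.range_succ, List.filter_append]
  simp [primesUpTo, h]

theorem length_minFacPartition (n : ℕ) : (minFacPartition n).length = (primesUpTo n).length := by
  simp [minFacPartition]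

theorem minFacPartition_succ_of_prime {n : ℕ} (hn : 1 ≤ n) (h : (n + 1).Prime) :
    minFacPartition (n + 1) = minFacPartition n ++ [{n + 1}] := by
  rw [minFacPartition, primesUpTo_succ_of_prime h, List.map_append, minFacPartition,
    List.map_singleton, minFacClass_succ_of_eq hn h.minFac_eq]
  congr 1
  · refine List.map_congr_left fun p hp => minFacClass_succ_of_ne ?_
    have := (mem_primesUpTo.mp hp).1
    rw [h.minFac_eq]
    omega
  · have : minFacClass (n + 1) n = ∅ := by
      refine Finset.eq_empty_of_forall_notMem fun m hm => ?_
      rw [mem_minFacClass] at hm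
      have := Nat.minFac_le (n := m) (by omega)
      omega
    rw [this]
    rfl

theorem minFacPartition_succ_of_not_prime {n j : ℕ} (hn : 1 ≤ n) (h : ¬ (n + 1).Prime)
    (hj : (primesUpTo n)[j]? = some (n + 1).minFac) :
    minFacPartition (n + 1) = (minFacPartition n).modify j (insert (n + 1)) := by
  refine List.ext_getElem? fun k => ?_
  rw [List.getElem?_modify, minFacPartition, minFacPartition, primesUpTo_succ_of_not_prime h,
    List.getElem?_map, List.getElem?_map]
  by_cases hk : j = k
  · subst hk
    simp [hj, minFacClass_succ_of_eq hn]
  · cases hq : (primesUpTo n)[k]? with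
    | none => simp
    | some q =>
      have hne : (n + 1).minFac ≠ q := by
        intro he
        rw [← he] at hq
        obtain ⟨h1, h1'⟩ := List.getElem?_eq_some_iff.mp hj
        obtain ⟨h2, h2'⟩ := List.getElem?_eq_some_iff.mp hq
        have hnd : (primesUpTo n).Nodup := (primesUpTo_sorted n).imp ne_of_lt
        exact hk ((hnd.getElem_inj_iff).mp (h1'.trans h2'.symm))
      simp [hk, minFacClass_succ_of_ne hne]

/-! ### Conflict counts of the candidates. -/

theorem sameClass_minFacPartition_append {n a : ℕ} (ha : a ≤ n) :
    ¬ SameClass (minFacPartition n ++ [{n + 1}]) a (n + 1) := by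
  rintro ⟨O, hO, h1, h2⟩
  rw [List.mem_append, List.mem_singleton] at hO
  rcases hO with hO | rfl
  · obtain ⟨p, -, rfl⟩ := List.mem_map.mp hO
    rw [mem_minFacClass] at h2
    omega
  · rw [Finset.mem_singleton] at h1
    omega

theorem sameClass_minFacPartition_modify {n j q a : ℕ} (hj : (primesUpTo n)[j]? = some q)
    (ha2 : 2 ≤ a) (ha : a ≤ n) :
    SameClass ((minFacPartition n).modify j (insert (n + 1))) a (n + 1) ↔ a.minFac = q := by
  have hmod : ∀ k, ((minFacPartition n).modify j (insert (n + 1)))[k]? =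
      (fun r => if j = k then insert (n + 1) (minFacClass r n) else minFacClass r n) <$>
        (primesUpTo n)[k]? := by
    intro k
    rw [List.getElem?_modify, minFacPartition, List.getElem?_map]
    cases (primesUpTo n)[k]? <;> by_cases hk : j = k <;> simp [hk]
  constructor
  · rintro ⟨O, hO, h1, h2⟩
    obtain ⟨k, hk⟩ := List.mem_iff_getElem?.mp hO
    rw [hmod] at hk
    by_cases hjk : j = k
    · subst hjk
      simp only [hj, if_true, Option.map_eq_map, Option.map_some, Option.some.injEq] at hk
      subst hk
      rw [Finset.mem_insert, mem_minFacClass] at h1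
      rcases h1 with h1 | h1
      · omega
      · exact h1.2
    · simp only [hjk, if_false, Option.map_eq_map, Option.map_eq_some_iff] at hk
      obtain ⟨r, -, rfl⟩ := hk
      rw [mem_minFacClass] at h2
      omega
  · intro h
    refine ⟨insert (n + 1) (minFacClass q n), ?_, ?_, Finset.mem_insert_self _ _⟩
    · refine List.mem_iff_getElem?.mpr ⟨j, ?_⟩
      rw [hmod, hj]
      simp
    · exact Finset.mem_insert_of_mem (mem_minFacClass.mpr ⟨⟨ha2, ha⟩, h⟩)

theorem newConflicts_append {n : ℕ} :
    newConflicts (minFacPartition n ++ [{n + 1}]) (n + 1) =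
      ((Finset.Ico 2 (n + 1)).filter (fun a => 1 < a.gcd (n + 1))).card := by
  unfold newConflicts
  congr 1
  refine Finset.filter_congr fun a ha => ?_
  have := sameClass_minFacPartition_append (n := n) (a := a)
    (by rw [Finset.mem_Ico] at ha; omega)
  simp [this]

/-- Only members of the class of `q` change status: those coprime to `n + 1` become conflicts and
the others cease to be. The identity is kept additive to avoid truncated subtraction. -/
theorem newConflicts_modify_add {n j q : ℕ} (hj : (primesUpTo n)[j]? = some q) :
    newConflicts ((minFacPartition n).modify j (insert (n + 1))) (n + 1) +
        ((Finset.Ico 2 (n + 1)).filter (fun a => a.minFac = q ∧ 1 < a.gcd (n + 1))).card =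
      ((Finset.Ico 2 (n + 1)).filter (fun a => a.minFac = q ∧ a.gcd (n + 1) = 1)).card +
        ((Finset.Ico 2 (n + 1)).filter (fun a => 1 < a.gcd (n + 1))).card := by
  unfold newConflicts
  simp only [Finset.card_filter]
  rw [← Finset.sum_add_distrib, ← Finset.sum_add_distrib]
  refine Finset.sum_congr rfl fun a ha => ?_
  rw [Finset.mem_Ico] at ha
  have hs := sameClass_minFacPartition_modify hj ha.1 (n := n) (by omega)
  have hg : 0 < a.gcd (n + 1) := Nat.gcd_pos_of_pos_right a (Nat.succ_pos n)
  rcases Nat.lt_or_ge 1 (a.gcd (n + 1)) with h2 | h2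
  · by_cases h1 : a.minFac = q <;> simp [hs, h1, h2, h2.ne']
  · have h2 : a.gcd (n + 1) = 1 := by omega
    by_cases h1 : a.minFac = q <;> simp [hs, h1, h2]

/-! ### Linear search for the first minimum. -/

/-- The result of a linear search for the first minimum is one of the candidates. -/
theorem foldl_argmin_mem {α : Type*} (c : α → ℕ) (g : ℕ → α) (init : α) (L : ℕ) :
    (List.range L).foldl (fun best j => if c (g j) < c best then g j else best) init = init ∨
    ∃ j < L, (List.range L).foldl (fun best j => if c (g j) < c best then g j else best) init
      = g j := by
  induction L with
  | zero => exact Or.inl rfl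
  | succ L ih =>
    rw [List.range_succ, List.foldl_append]
    simp only [List.foldl_cons, List.foldl_nil]
    split_ifs with h
    · exact Or.inr ⟨L, by omega, rfl⟩
    · rcases ih with ih | ⟨j, hj, ih⟩
      · exact Or.inl ih
      · exact Or.inr ⟨j, by omega, ih⟩

theorem foldl_argmin_eq {α : Type*} (c : α → ℕ) (g : ℕ → α) (init : α) (L k : ℕ)
    (hk : k < L) (h0 : c (g k) < c init) (hlt : ∀ j < k, c (g k) < c (g j))
    (hle : ∀ j < L, k < j → c (g k) ≤ c (g j)) :
    (List.range L).foldl (fun best j => if c (g j) < c best then g j else best) init = g k := by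
  induction L with
  | zero => omega
  | succ L ih =>
    rw [List.range_succ, List.foldl_append]
    simp only [List.foldl_cons, List.foldl_nil]
    rcases Nat.lt_or_ge k L with h | h
    · rw [ih h fun j hj => hle j (by omega)]
      exact if_neg (not_lt.mpr (hle L (by omega) h))
    · obtain rfl : k = L := by omega
      refine if_pos ?_
      rcases foldl_argmin_mem c g init k with h1 | ⟨j, hj, h1⟩
      · rw [h1]; exact h0
      · rw [h1]; exact hlt j hj

theorem foldl_argmin_eq_init {α : Type*} (c : α → ℕ) (g : ℕ → α) (init : α) (L : ℕ)
    (h0 : c init = 0) :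
    (List.range L).foldl (fun best j => if c (g j) < c best then g j else best) init = init := by
  induction L with
  | zero => rfl
  | succ L ih =>
    rw [List.range_succ, List.foldl_append, ih]
    simp [h0]

/-! ### One step of the algorithm. -/

theorem greedyStep_of_prime {n : ℕ} (hn : 1 ≤ n) (h : (n + 1).Prime) :
    greedyStep (minFacPartition n) (n + 1) = minFacPartition (n + 1) := by
  rw [minFacPartition_succ_of_prime hn h]
  refine foldl_argmin_eq_init (fun P => newConflicts P (n + 1)) _ _ _ ?_
  rw [newConflicts_append, Finset.card_eq_zero]
  refine Finset.filter_eq_empty_iff.mpr fun a ha => ?_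
  rw [Finset.mem_Ico] at ha
  have : a.gcd (n + 1) = 1 :=
    (Nat.coprime_of_lt_prime (by omega) ha.2 h).symm
  omega

theorem exists_index_minFac {n : ℕ} (hn : 1 ≤ n) (h : ¬ (n + 1).Prime) :
    ∃ j : ℕ, (primesUpTo n)[j]? = some (n + 1).minFac := by
  refine List.mem_iff_getElem?.mp (mem_primesUpTo.mpr ⟨?_, Nat.minFac_prime (by omega)⟩)
  have h1 := Nat.minFac_le (n := n + 1) (by omega)
  have h2 : (n + 1).minFac ≠ n + 1 := fun h3 => h (h3 ▸ Nat.minFac_prime (by omega))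
  omega

/-- The output is one of the candidates, and only one of them puts `n + 1` together with its
smallest prime factor. -/
theorem greedyStep_of_sameClass {n : ℕ} (hn : 1 ≤ n) (h : ¬ (n + 1).Prime)
    (hs : SameClass (greedyStep (minFacPartition n) (n + 1)) (n + 1) (n + 1).minFac) :
    greedyStep (minFacPartition n) (n + 1) = minFacPartition (n + 1) := by
  obtain ⟨k, hk⟩ := exists_index_minFac hn h
  have hpp : (n + 1).minFac.Prime := Nat.minFac_prime (by omega)
  have hle : (n + 1).minFac ≤ n := (mem_primesUpTo.mp (List.mem_of_getElem? hk)).1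
  have hs' : SameClass (greedyStep (minFacPartition n) (n + 1)) (n + 1).minFac (n + 1) := by
    obtain ⟨O, hO, h1, h2⟩ := hs
    exact ⟨O, hO, h2, h1⟩
  rcases foldl_argmin_mem (fun P => newConflicts P (n + 1))
    (fun j => (minFacPartition n).modify j (insert (n + 1))) (minFacPartition n ++ [{n + 1}])
    (minFacPartition n).length with h1 | ⟨j, hj, h1⟩
  · change greedyStep (minFacPartition n) (n + 1) = _ at h1
    rw [h1] at hs'
    exact absurd hs' (sameClass_minFacPartition_append hle)
  · change greedyStep (minFacPartition n) (n + 1) = _ at h1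
    rw [length_minFacPartition] at hj
    have hq := List.getElem?_eq_getElem hj
    rw [h1] at hs'
    rw [sameClass_minFacPartition_modify hq hpp.two_le hle, hpp.minFac_eq] at hs'
    rw [h1, minFacPartition_succ_of_not_prime hn h (hs' ▸ hq)]

/-- The map `q * b ↦ p * b` is an injection: a `q`-rough cofactor is also `p`-rough, and the product
does not grow. -/
theorem card_minFac_eq_le {p q n : ℕ} (hp : p.Prime) (hq : q.Prime) (hpq : p ≤ q) :
    ((Finset.Ico 2 n).filter (fun a => a.minFac = q)).card ≤
      ((Finset.Ico 2 n).filter (fun a => a.minFac = p)).card := by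
  refine Finset.card_le_card_of_injOn (fun a => p * (a / q)) ?_ ?_
  · intro a ha
    simp only [Finset.coe_filter, Finset.mem_Ico, Set.mem_ofPred_eq] at ha ⊢
    obtain ⟨⟨h1, h2⟩, h3⟩ := ha
    obtain ⟨b, hb⟩ : q ∣ a := h3 ▸ Nat.minFac_dvd a
    have hr : IsRough p b :=
      ((h3 ▸ isRough_minFac a : IsRough q a).of_dvd ⟨q, by rw [hb, mul_comm]⟩).mono hpq
    have hb0 : 0 < b := Nat.pos_of_ne_zero (by rintro rfl; omega)
    have hd : a / q = b := by rw [hb, Nat.mul_div_cancel_left _ hq.pos]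
    rw [hd]
    refine ⟨⟨?_, ?_⟩, minFac_mul_of_isRough hp hr⟩
    · nlinarith [hp.two_le]
    · exact lt_of_le_of_lt (Nat.mul_le_mul_right b hpq) (hb ▸ h2)
  · intro a ha b hb hab
    simp only [Finset.coe_filter, Set.mem_ofPred_eq] at ha hb
    have := Nat.eq_of_mul_eq_mul_left hp.pos hab
    exact (Nat.div_left_inj (ha.2 ▸ Nat.minFac_dvd a) (hb.2 ▸ Nat.minFac_dvd b)).mp this

/-- Multiplication by `q` carries the `q`-rough numbers up to `(n - 1) / q` onto the class of `q`
below `n`, and preserves the gcd with `n` because `q` does not divide `n`. -/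
theorem card_minFac_not_coprime_le_coprime {n q : ℕ}
    (hn2 : 2 ≤ n) (hlarge : ∀ q : ℕ, q.Prime → q ∣ n → 41 ≤ q) (hcomp : ¬ n.Prime)
    (hq : q.Prime) (hqp : q < n.minFac) (hn : n < 111546435) :
    ((Finset.Ico 2 n).filter (fun a => a.minFac = q ∧ 1 < a.gcd n)).card ≤
      ((Finset.Ico 2 n).filter (fun a => a.minFac = q ∧ a.gcd n = 1)).card := by
  classical
  have hqn : q.Coprime n := (Nat.Prime.coprime_iff_not_dvd hq).mpr fun hd =>
    absurd (Nat.minFac_le_of_dvd hq.two_le hd) (not_le.mpr hqp)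
  have hg : ∀ m, (q * m).gcd n = m.gcd n := fun m => Nat.Coprime.gcd_mul_left_cancel m hqn
  have hx : ∀ k, k ≤ (n - 1) / q ↔ q * k < n := fun k => by
    rw [Nat.le_div_iff_mul_le hq.pos, mul_comm]; omega
  refine le_trans ?_ ((card_rough_not_coprime_le_coprime_of_composite
    hn2 hn hlarge hcomp hq hqp).trans ?_)
  · refine Finset.card_le_card_of_injOn (· / q) ?_ ?_
    · intro a ha
      simp only [Finset.coe_filter, Finset.mem_Ico, Finset.mem_Icc, Set.mem_ofPred_eq] at ha ⊢
      obtain ⟨⟨h1, h2⟩, h3, h4⟩ := ha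
      obtain ⟨b, hb⟩ : q ∣ a := h3 ▸ Nat.minFac_dvd a
      have hr : IsRough q b :=
        (h3 ▸ isRough_minFac a : IsRough q a).of_dvd ⟨q, by rw [hb, mul_comm]⟩
      have hb0 : 0 < b := Nat.pos_of_ne_zero (by rintro rfl; omega)
      have hd : a / q = b := by rw [hb, Nat.mul_div_cancel_left _ hq.pos]
      rw [hd]
      exact ⟨⟨hb0, (hx b).mpr (hb ▸ h2)⟩, hr, by rwa [hb, hg] at h4⟩
    · intro a ha b hb hab
      simp only [Finset.coe_filter, Set.mem_ofPred_eq] at ha hb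
      exact (Nat.div_left_inj (ha.2.1 ▸ Nat.minFac_dvd a) (hb.2.1 ▸ Nat.minFac_dvd b)).mp hab
  · refine Finset.card_le_card_of_injOn (q * ·) ?_ ?_
    · intro m hm
      simp only [Finset.coe_filter, Finset.mem_Ico, Finset.mem_Icc, Set.mem_ofPred_eq] at hm ⊢
      obtain ⟨⟨h1, h2⟩, h3, h4⟩ := hm
      refine ⟨⟨?_, (hx m).mp h2⟩, minFac_mul_of_isRough hq h3, by rwa [hg]⟩
      nlinarith [hq.two_le]
    · intro a _ b _ hab
      exact Nat.eq_of_mul_eq_mul_left hq.pos hab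

theorem greedyStep_of_large {n : ℕ} (hn : 1 ≤ n) (h : ¬ (n + 1).Prime)
    (hlarge : ∀ q : ℕ, q.Prime → q ∣ n + 1 → 41 ≤ q) (hlt : n + 1 < 111546435) :
    greedyStep (minFacPartition n) (n + 1) = minFacPartition (n + 1) := by
  obtain ⟨k, hk⟩ := exists_index_minFac hn h
  have hpp : (n + 1).minFac.Prime := Nat.minFac_prime (by omega)
  have hle : (n + 1).minFac ≤ n := (mem_primesUpTo.mp (List.mem_of_getElem? hk)).1
  rw [minFacPartition_succ_of_not_prime hn h hk]
  have hdvd : ∀ a : ℕ, a.minFac = (n + 1).minFac → a.gcd (n + 1) ≠ 1 := fun a ha hg =>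
    hpp.ne_one (Nat.eq_one_of_dvd_coprimes hg (ha ▸ Nat.minFac_dvd a) (Nat.minFac_dvd _))
  have hgt : ∀ a ∈ Finset.Ico 2 (n + 1), a.gcd (n + 1) = 1 ∨ 1 < a.gcd (n + 1) := by
    intro a _
    have : 0 < a.gcd (n + 1) := Nat.gcd_pos_of_pos_right a (Nat.succ_pos n)
    omega
  have hown := newConflicts_modify_add hk
  have hown1 : ((Finset.Ico 2 (n + 1)).filter
      (fun a => a.minFac = (n + 1).minFac ∧ a.gcd (n + 1) = 1)).card = 0 := by
    rw [Finset.card_eq_zero]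
    exact Finset.filter_eq_empty_iff.mpr fun a _ ha => hdvd a ha.1 ha.2
  have hown2 : (Finset.Ico 2 (n + 1)).filter
      (fun a => a.minFac = (n + 1).minFac ∧ 1 < a.gcd (n + 1)) =
      (Finset.Ico 2 (n + 1)).filter (fun a => a.minFac = (n + 1).minFac) :=
    Finset.filter_congr fun a ha =>
      ⟨fun h => h.1, fun h => ⟨h, (hgt a ha).resolve_left (hdvd a h)⟩⟩
  -- The class already contains its prime, which makes the comparisons with the new class and with
  -- the earlier classes strict, as the tie-breaking rule demands.
  have hpos : 0 < ((Finset.Ico 2 (n + 1)).filter (fun a => a.minFac = (n + 1).minFac)).card :=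
    Finset.card_pos.mpr ⟨(n + 1).minFac, Finset.mem_filter.mpr
      ⟨Finset.mem_Ico.mpr ⟨hpp.two_le, by omega⟩, hpp.minFac_eq⟩⟩
  rw [hown1, hown2] at hown
  obtain ⟨hkL, hkp⟩ := List.getElem?_eq_some_iff.mp hk
  have hsorted := List.pairwise_iff_getElem.mp (primesUpTo_sorted n)
  refine foldl_argmin_eq (fun P => newConflicts P (n + 1))
    (fun j => (minFacPartition n).modify j (insert (n + 1))) _ _ k ?_ ?_ ?_ ?_
  · rwa [length_minFacPartition]
  · simp only [newConflicts_append]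
    omega
  · intro j hj
    have hjL : j < (primesUpTo n).length := hj.trans hkL
    have hother := newConflicts_modify_add (List.getElem?_eq_getElem hjL)
    have := card_minFac_not_coprime_le_coprime (by omega) hlarge h
      (mem_primesUpTo.mp (List.getElem_mem hjL)).2 (hkp ▸ hsorted j k hjL hkL hj) hlt
    omega
  · intro j hj hkj
    rw [length_minFacPartition] at hj
    have hother := newConflicts_modify_add (List.getElem?_eq_getElem hj)
    have h1 := card_minFac_eq_le (n := n + 1) hpp (mem_primesUpTo.mp (List.getElem_mem hj)).2
      (hkp ▸ hsorted k j hkL hj hkj).le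
    have h2 : ((Finset.Ico 2 (n + 1)).filter
        (fun a => a.minFac = (primesUpTo n)[j] ∧ 1 < a.gcd (n + 1))).card ≤
        ((Finset.Ico 2 (n + 1)).filter (fun a => a.minFac = (primesUpTo n)[j])).card :=
      Finset.card_le_card fun a ha => by
        simp only [Finset.mem_filter] at ha ⊢
        exact ⟨ha.1, ha.2.1⟩
    omega

/-! ### Induction and conclusion. -/

theorem minFacPartition_two : minFacPartition 2 = [{2}] := by
  have h : minFacPartition 1 = [] := by decide
  rw [minFacPartition_succ_of_prime le_rfl Nat.prime_two, h]
  rfl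

theorem greedy_eq_minFacPartition {n : ℕ} (hn2 : 2 ≤ n) (hn : n < 111546435)
    (hsmall : ∀ m : ℕ, 2 ≤ m → m ≤ n → (∃ q : ℕ, q.Prime ∧ q ≤ 37 ∧ q ∣ m) →
      SameClass (greedy m) m m.minFac) : greedy n = minFacPartition n := by
  induction n, hn2 using Nat.le_induction with
  | base => exact minFacPartition_two.symm
  | succ n hn2 ih =>
    have ih := ih (by omega) fun m h1 h2 => hsmall m h1 (by omega)
    have hg : greedy (n + 1) = greedyStep (minFacPartition n) (n + 1) := by
      rw [← ih]
      -- The recursive clause of `greedy` matches only arguments of the form `k + 3`.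
      obtain ⟨k, rfl⟩ := Nat.exists_eq_add_of_le' hn2
      rfl
    rw [hg]
    by_cases hp : (n + 1).Prime
    · exact greedyStep_of_prime (by omega) hp
    by_cases hq : ∃ q : ℕ, q.Prime ∧ q ≤ 37 ∧ q ∣ n + 1
    · exact greedyStep_of_sameClass (by omega) hp (hg ▸ hsmall (n + 1) (by omega) le_rfl hq)
    · refine greedyStep_of_large (by omega) hp (fun q hq1 hq2 => ?_) hn
      by_contra! h41
      refine hq ⟨q, hq1, ?_, hq2⟩
      by_contra! h37
      -- None of 38, 39, 40 is prime.
      interval_cases q <;> revert hq1 <;> norm_num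

theorem smallestPrimeClass_eq_minFacClass {i p n : ℕ} (hi : 1 ≤ i) (hp : p.Prime)
    (hpi : nthPrime i = p) : smallestPrimeClass i n = minFacClass p n := by
  -- A prime `q` has index `Nat.count Nat.Prime q + 1`, the shift coming from the one-based
  -- numbering of the primes.
  have hlt : ∀ q : ℕ, q.Prime → (q < p ↔ ∃ j, 1 ≤ j ∧ j < i ∧ nthPrime j = q) := by
    intro q hq
    rw [← hpi]
    unfold nthPrime
    constructor
    · intro h
      refine ⟨Nat.count Nat.Prime q + 1, by omega, ?_, by simpa using Nat.nth_count hq⟩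
      rw [← Nat.nth_count hq, Nat.nth_lt_nth Nat.infinite_setOfPred_prime] at h
      omega
    · rintro ⟨j, h1, h2, rfl⟩
      exact (Nat.nth_lt_nth Nat.infinite_setOfPred_prime).mpr (by omega)
  ext m
  unfold smallestPrimeClass
  simp only [mem_minFacClass, Finset.mem_filter, Finset.mem_Icc, hpi]
  constructor
  · rintro ⟨⟨h1, h2⟩, h3, h4⟩
    have hm2 : 2 ≤ m := hp.two_le.trans (Nat.le_of_dvd h1 h3)
    refine ⟨⟨hm2, h2⟩, le_antisymm (Nat.minFac_le_of_dvd hp.two_le h3) ?_⟩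
    by_contra! h
    obtain ⟨j, hj1, hj2, hj3⟩ := (hlt _ (Nat.minFac_prime (by omega))).mp h
    exact h4 j hj1 hj2 (hj3 ▸ Nat.minFac_dvd m)
  · rintro ⟨⟨h1, h2⟩, rfl⟩
    refine ⟨⟨by omega, h2⟩, Nat.minFac_dvd m, fun j hj1 hj2 hd => ?_⟩
    have hjp : (nthPrime j).Prime := Nat.prime_nth_prime _
    have := (hlt _ hjp).mpr ⟨j, hj1, hj2, rfl⟩
    exact absurd (Nat.minFac_le_of_dvd hjp.two_le hd) (not_le.mpr this)

theorem mainTheorem2 (n : ℕ) (hn2 : 2 ≤ n)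
    (hn : n < 3 * 5 * 7 * 11 * 13 * 17 * 19 * 23)
    (hlarge : ∀ q : ℕ, q.Prime → q ∣ n → 41 ≤ q)
    (hsmall : ∀ m : ℕ, 2 ≤ m → m < n → (∃ q : ℕ, q.Prime ∧ q ≤ 37 ∧ q ∣ m) →
      SameClass (greedy m) m m.minFac)
    (i : ℕ) (hi : 1 ≤ i) (hpi : nthPrime i = n.minFac) :
    n ∈ smallestPrimeClass i n ∧ smallestPrimeClass i n ∈ greedy n := by
  have hpp : n.minFac.Prime := Nat.minFac_prime (by omega)
  rw [smallestPrimeClass_eq_minFacClass hi hpp hpi,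
    greedy_eq_minFacPartition hn2 (hn.trans_le (by norm_num)) fun m h1 h2 hq => ?_]
  · exact ⟨mem_minFacClass.mpr ⟨⟨hn2, le_rfl⟩, rfl⟩, List.mem_map.mpr
      ⟨_, mem_primesUpTo.mpr ⟨Nat.minFac_le (by omega), hpp⟩, rfl⟩⟩
  -- The induction also asks about `m = n`, where a prime factor at most 37 would contradict
  -- `hlarge`.
  · rcases h2.lt_or_eq with h | rfl
    · exact hsmall m h1 h hq
    · obtain ⟨q, hq1, hq2, hq3⟩ := hq
      have := hlarge q hq1 hq3
      omega
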